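/- Let $\Gamma$ be a connected negative definite plumbing graph whose link is a rational homology sphere, i.e. a finite tree with vertex set $\mathcal V$, all genera zero, an integer Euler number at every vertex, and negative definite intersection form $(\cdot,\cdot)$ on $L=\mathbb Z\langle E_v\rangle_{v\in\mathcal V}$ (the diagonal entries are the Euler numbers; $(E_v,E_w)=1$ if $v\ne w$ are adjacent and $0$ otherwise). Let $L'\subset L\otimes\mathbb Q$ be the dual lattice, with basis $E_v^*$ defined by $(E_v^*,E_w)=-1$ if $v=w$ and $0$ otherwise, and let $H=L'/L$. Let $\delta_v$ be the valency of $v$ and $\mathcal N=\{v:\delta_v\ge 3\}$ the set of nodes, assumed non-empty. The orbifold graph $\Gamma^{orb}$ has vertex set $\mathcal N$, two distinct nodes being adjacent if they are joined in $\Gamma$ by a path whose interior vertices all have valency $2$; $\delta_{n,\mathcal N}$ is the valency of $n$ in $\Gamma^{orb}$. For $l'=\sum_v l_vE_v\in L'$ write $\mathbf t^{l'}=\prod_v t_v^{l_v}$, let $Z(\mathbf t)=\sum_{l'}z_{l'}\mathbf t^{l'}$ be the Taylor expansion at the origin of $f(\mathbf t)=\prod_{v\in\mathcal V}(1-\mathbf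 t^{E_v^*})^{\delta_v-2}$, and for $h\in H$ let $f_h(\mathbf t)$ be the rational function with Taylor expansion $Z_h(\mathbf t)=\sum_{[l']=h}z_{l'}\mathbf t^{l'}$. The reduced equivariant zeta-function is $f_h(\mathbf t_{\mathcal N})=f_h(\mathbf t)|_{t_v=1,\,v\notin\mathcal N}$. All Laurent polynomials below have integer coefficients and rational exponents $\beta=(\beta_n)_{n\in\mathcal N}$, and $\beta<\gamma$ means $\beta_n<\gamma_n$ for all $n\in\mathcal N$. * The multivariable quotient $P_h^+(\mathbf t_{\mathcal N})=\sum_\beta p_\beta\mathbf t_{\mathcal N}^\beta$ of $f_h(\mathbf t_{\mathcal N})$ is the Laurent polynomial for which there are Laurent polynomials $A,B,R$ with $f_h(\mathbf t_{\mathcal N})=B/A$ and $B=P_h^+A+R$, where $A$ has an exponent $a>0$ such that all its other exponents are $<a$, all exponents of $R$ are $<a$, and no exponent $\beta$ of $P_h^+$ satisfies $\beta<0$. * For a non-empty $S\subset\mathcal N$, the polynomial part of $f_h(\mathbf t_{\mathcal N})$ in the variables $t_n$, $n\in S$, is the Laurent polynomial $P_h^S$ such that every exponent $\beta$ of $P_h^S$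 has $\beta_n\ge0$ for some $n\in S$, and $f_h(\mathbf t_{\mathcal N})-P_h^S$ is a rational function with negative degree in $t_n$ for every $n\in S$. Put $P_h^n=P_h^{\{n\}}$ and $P_h^{n,n'}=P_h^{\{n,n'\}}$. The László–Szilágyi polynomial part is $$P_h(\mathbf t_{\mathcal N})=\sum_{\overline{nn'}\text{ edge of }\Gamma^{orb}}P_h^{n,n'}(\mathbf t_{\mathcal N})-\sum_{n\in\mathcal N}(\delta_{n,\mathcal N}-1)P_h^n(\mathbf t_{\mathcal N}).$$ * Fix a node $n_0\in\mathcal N$, orient the edges of $\Gamma^{orb}$ towards $n_0$, and write $n>n'$ if there is an edge oriented from $n$ to $n'$. Put $\mathfrak s_{n}(\beta)=1$ if $\beta_{n}\ge0$ and $0$ otherwise; for $n>n'$ put $\mathfrak s_{n>n'}(\beta)=1$ if $\beta_n\ge0$ and $\beta_{n'}<0$, and $0$ otherwise; and let $\mathfrak s(\beta)=\mathfrak s_{n_0}(\beta)+\sum_{n>n'}\mathfrak s_{n>n'}(\beta)$. **Theorem.** For every $h\in H$ and every choice of $n_0\in\mathcal N$, the objects $f_h(\mathbf t_{\mathcal N})$,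 $P_h^+$ and $P_h$ exist and are uniquely determined by the above descriptions, and $$P_h(\mathbf t_{\mathcal N})=\sum_\beta \mathfrak s(\beta)\,p_\beta\,\mathbf t_{\mathcal N}^\beta .$$ -/

import Mathlib

noncomputable section

open Classical in
/-- The intersection matrix of a decorated graph: the Euler numbers on the diagonal, and off the
diagonal `1` for adjacent vertices and `0` otherwise. -/
def plumbingMatrix {V : Type*} (G : SimpleGraph V) (e : V → ℤ) : Matrix V V ℚ :=
  Matrix.of fun v w => if v = w then (e v : ℚ) else if G.Adj v w then 1 else 0

/-- A connected negative definite plumbing graph of a rational homology sphere: a finite tree with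
an integral Euler number at every vertex (all genera are zero) and negative definite intersection
form. -/
structure PlumbingTree (V : Type*) [Fintype V] where
  graph : SimpleGraph V
  isTree : graph.IsTree
  euler : V → ℤ
  negDef : ∀ x : V → ℚ, x ≠ 0 → x ⬝ᵥ (plumbingMatrix graph euler).mulVec x < 0

/-- Laurent polynomials with integer coefficients and rational exponents in the variables `t_n`,
`n ∈ N`; the monomial `t^β` is `AddMonoidAlgebra.single β 1`. -/
abbrev Laurent (N : Type*) := AddMonoidAlgebra ℤ (N → ℚ)

/-- Quotients of such Laurent polynomials. -/
abbrev LaurentFrac (N : Type*) := FractionRing (Laurent N)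

/-- The set of exponents of the monomials that occur in a Laurent polynomial. -/
def Laurent.exponents {N : Type*} (P : Laurent N) : Finset (N → ℚ) := P.coeff.support

/-- The rational function `g` has negative degree in `t_n`: it can be written as `R / A` such that
the degree of `R` in `t_n` is smaller than the degree of `A` in `t_n`. -/
def HasNegDegree {N : Type*} (n : N) (g : LaurentFrac N) : Prop :=
  ∃ R A : Laurent N, A ≠ 0 ∧
    g = algebraMap (Laurent N) (LaurentFrac N) R / algebraMap (Laurent N) (LaurentFrac N) A ∧
    ∃ a ∈ A.exponents, ∀ r ∈ R.exponents, r n < a n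

/-- `P` is the polynomial part of `f`, viewed as a rational function in the variables `t_n`,
`n ∈ S`, with the other variables as coefficients: no exponent of `P` is negative in all directions
of `S`, and `f - P` has negative degree in `t_n` for all `n ∈ S`. -/
def IsPolynomialPartIn {N : Type*} (S : Set N) (f : LaurentFrac N) (P : Laurent N) : Prop :=
  (∀ β ∈ P.exponents, ¬ ∀ n ∈ S, β n < 0) ∧
  ∀ n ∈ S, HasNegDegree n (f - algebraMap (Laurent N) (LaurentFrac N) P)

/-- `Q` is the quotient of the multivariable Euclidean division of the numerator by the denominator
of `f`: one has `f = B / A`, the Laurent polynomial `A` has a unique maximal exponent `a`, with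
`a > 0`, and `B = Q * A + R`, where no exponent `β` of `Q` satisfies `β < 0`, and all exponents `ρ`
of `R` satisfy `ρ < a`. Here `l₁ < l₂` means strict inequality in every coordinate. -/
def IsDivisionQuotient {N : Type*} (f : LaurentFrac N) (Q : Laurent N) : Prop :=
  ∃ (A B R : Laurent N) (a : N → ℚ),
    a ∈ A.exponents ∧ (∀ b ∈ A.exponents, b ≠ a → ∀ n, b n < a n) ∧ (∀ n, 0 < a n) ∧
    f = algebraMap (Laurent N) (LaurentFrac N) B / algebraMap (Laurent N) (LaurentFrac N) A ∧
    B = Q * A + R ∧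
    (∀ β ∈ Q.exponents, ¬ ∀ n, β n < 0) ∧
    ∀ ρ ∈ R.exponents, ∀ n, ρ n < a n

/-- The lattice `L`, freely generated by the `E_v`, in `L ⊗ ℚ`. -/
def intLattice (V : Type*) : AddSubgroup (V → ℚ) where
  carrier := {x | ∀ v, ∃ k : ℤ, x v = k}
  zero_mem' := fun _ => ⟨0, by simp⟩
  add_mem' := fun {x y} hx hy v => by
    obtain ⟨k, hk⟩ := hx v
    obtain ⟨l, hl⟩ := hy v
    exact ⟨k + l, by simp [hk, hl]⟩
  neg_mem' := fun {x} hx v => by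
    obtain ⟨k, hk⟩ := hx v
    exact ⟨-k, by simp [hk]⟩

namespace PlumbingTree

variable {V : Type*} [Fintype V] (Γ : PlumbingTree V)

/-- The intersection form on `L ⊗ ℚ`, with respect to the basis `E_v`. -/
def form (x y : V → ℚ) : ℚ := x ⬝ᵥ (plumbingMatrix Γ.graph Γ.euler).mulVec y

/-- The dual lattice `L'`, embedded in `L ⊗ ℚ` by the intersection form. -/
def dualLattice : AddSubgroup (V → ℚ) where
  carrier := {x | ∀ y ∈ intLattice V, ∃ k : ℤ, Γ.form x y = k}
  zero_mem' := fun _ _ => ⟨0, by simp [form]⟩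
  add_mem' := fun {x y} hx hy z hz => by
    obtain ⟨k, hk⟩ := hx z hz
    obtain ⟨l, hl⟩ := hy z hz
    refine ⟨k + l, ?_⟩
    simp only [form] at hk hl ⊢
    rw [add_dotProduct, hk, hl]
    push_cast
    rfl
  neg_mem' := fun {x} hx z hz => by
    obtain ⟨k, hk⟩ := hx z hz
    refine ⟨-k, ?_⟩
    simp only [form] at hk ⊢
    rw [neg_dotProduct, hk]
    push_cast
    rfl

/-- The group `H = L' / L`. -/
abbrev H := Γ.dualLattice ⧸ (intLattice V).addSubgroupOf Γ.dualLattice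

theorem det_ne_zero [DecidableEq V] : (plumbingMatrix Γ.graph Γ.euler).det ≠ 0 := by
  intro h
  obtain ⟨x, hx, hx0⟩ := Matrix.exists_mulVec_eq_zero_iff.mpr h
  have := Γ.negDef x hx
  rw [hx0] at this
  simp at this

open Classical in
/-- The coordinates of `E_v^*` in the basis `E_w`, as column `v` of `-I⁻¹`. -/
def dualVec (v : V) : V → ℚ :=
  -((plumbingMatrix Γ.graph Γ.euler)⁻¹.mulVec (Pi.single v 1))

theorem plumbingMatrix_transpose :
    (plumbingMatrix Γ.graph Γ.euler).transpose = plumbingMatrix Γ.graph Γ.euler := by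
  ext v w
  simp only [plumbingMatrix, Matrix.transpose_apply, Matrix.of_apply]
  by_cases h : v = w
  · subst h; rfl
  · rw [if_neg h, if_neg (Ne.symm h)]
    by_cases g : Γ.graph.Adj v w
    · rw [if_pos g, if_pos g.symm]
    · rw [if_neg g, if_neg fun g' => g g'.symm]

open Classical in
theorem form_dualVec (v : V) (y : V → ℚ) : Γ.form (Γ.dualVec v) y = - y v := by
  have hu : IsUnit (plumbingMatrix Γ.graph Γ.euler).det := (Γ.det_ne_zero).isUnit
  rw [form, Matrix.dotProduct_mulVec, ← Matrix.mulVec_transpose, plumbingMatrix_transpose, dualVec,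
    Matrix.mulVec_neg, Matrix.mulVec_mulVec, Matrix.mul_nonsing_inv _ hu, Matrix.one_mulVec]
  simp

/-- The anti-dual basis element `E_v^*` of `L'`, for which `(E_v^*, E_w)` is `-1` for `w = v` and
`0` otherwise. -/
def dual (v : V) : Γ.dualLattice :=
  ⟨Γ.dualVec v, fun y hy => by
    obtain ⟨k, hk⟩ := hy v
    exact ⟨-k, by rw [form_dualVec, hk]; push_cast; rfl⟩⟩

/-- The class in `H` of `∑ v, m_v E_v^*`. -/
def expClass (m : V →₀ ℕ) : Γ.H :=
  QuotientAddGroup.mk (∑ v, m v • Γ.dual v)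

/-- The valency `δ_v`. -/
def valency (v : V) : ℕ := (Γ.graph.neighborSet v).ncard

/-- The nodes: vertices of valency at least three. -/
abbrev Node := {v : V // 3 ≤ Γ.valency v}

/-- The product of the factors of `∏ v, (1 - t^{E_v^*})^{δ_v - 2}` with `δ_v ≥ 2` (the truncated
subtraction gives exponent `0` to the other factors). Here and in what follows the variable `X v`
stands for the monomial `t^{E_v^*}`: as the `E_v^*` are linearly independent, polynomials and power
series in the `X v` are the same as polynomials and series in `t` supported on the monoid generated
by the `E_v^*`. -/
def zetaNum : MvPolynomial V ℤ := ∏ v, (1 - MvPolynomial.X v) ^ (Γ.valency v - 2)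

/-- The denominator of `∏ v, (1 - t^{E_v^*})^{δ_v - 2}`: the product of the factors with
`δ_v < 2`, with the opposite exponent. -/
def zetaDen : MvPolynomial V ℤ := ∏ v, (1 - MvPolynomial.X v) ^ (2 - Γ.valency v)

/-- The topological Poincaré series `Z`: the Taylor expansion at the origin of the multivariable
zeta-function `f = ∏ v, (1 - t^{E_v^*})^{δ_v - 2}`. -/
def poincareSeries : MvPowerSeries V ℤ :=
  (Γ.zetaNum : MvPowerSeries V ℤ) * MvPowerSeries.invOfUnit (Γ.zetaDen : MvPowerSeries V ℤ) 1

theorem zetaDen_mul_poincareSeries :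
    (Γ.zetaDen : MvPowerSeries V ℤ) * Γ.poincareSeries = Γ.zetaNum := by
  rw [poincareSeries, mul_left_comm, MvPowerSeries.mul_invOfUnit, mul_one]
  rw [zetaDen, ← MvPolynomial.coeToMvPowerSeries.ringHom_apply]
  have hv (v : V) : MvPowerSeries.constantCoeff
      ((1 - MvPolynomial.X v : MvPolynomial V ℤ) : MvPowerSeries V ℤ) = 1 := by
    rw [← MvPolynomial.coeToMvPowerSeries.ringHom_apply, map_sub]
    simp
  simp [map_prod, hv]

open Classical in
/-- The `h`-equivariant part `Z_h` of the Poincaré series: the sum of the terms `p_{l'} t^{l'}` with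
`[l'] = h`. -/
def poincareSeriesPart (h : Γ.H) : MvPowerSeries V ℤ :=
  fun m => if Γ.expClass m = h then MvPowerSeries.coeff m Γ.poincareSeries else 0

/-- The substitution `t_v = 1` for all `v` that are not nodes; it maps `X v = t^{E_v^*}` to the
monomial in the remaining variables whose exponent is the projection of `E_v^*`. -/
def reduce : MvPolynomial V ℤ →ₐ[ℤ] Laurent Γ.Node :=
  MvPolynomial.aeval fun v =>
    AddMonoidAlgebra.single (fun n : Γ.Node => (Γ.dual v : V → ℚ) n) (1 : ℤ)

/-- `f` is the reduced zeta-function `f_h(t_N)`: the rational function `f_h`, whose Taylor expansion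
at the origin is `Z_h`, is `B / A` (that is, `A * Z_h = B`), and `f` arises from `B / A` by
substituting `t_v = 1` for all `v` that are not nodes. -/
def IsReducedZeta (h : Γ.H) (f : LaurentFrac Γ.Node) : Prop :=
  ∃ A B : MvPolynomial V ℤ,
    (A : MvPowerSeries V ℤ) * Γ.poincareSeriesPart h = (B : MvPowerSeries V ℤ) ∧
    Γ.reduce A ≠ 0 ∧
    f = algebraMap (Laurent Γ.Node) (LaurentFrac Γ.Node) (Γ.reduce B) /
      algebraMap (Laurent Γ.Node) (LaurentFrac Γ.Node) (Γ.reduce A)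

/-- The orbifold graph: its vertices are the nodes, and two distinct nodes are adjacent if they are
joined by a path all of whose interior vertices have valency two. -/
def orbGraph : SimpleGraph Γ.Node where
  Adj n n' := n ≠ n' ∧ ∃ p : Γ.graph.Walk n n', p.IsPath ∧
    ∀ v ∈ p.support, v ≠ n → v ≠ n' → Γ.valency v = 2
  symm := ⟨by
    rintro n n' ⟨hne, p, hp, hv⟩
    exact ⟨hne.symm, p.reverse, hp.reverse,
      fun v hvp h1 h2 => hv v (by simpa using hvp) h2 h1⟩⟩
  loopless := ⟨fun _ h => h.1 rfl⟩

/-- The valency `δ_{n,N}` of the node `n` in the orbifold graph. -/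
def orbValency (n : Γ.Node) : ℕ := (Γ.orbGraph.neighborSet n).ncard

open Classical in
/-- `P` is the polynomial part of `f` in the sense of László and Szilágyi: the sum over the edges
`nn'` of the orbifold graph of the polynomial parts in the variables `t_n, t_{n'}`, minus the sum
over the nodes `n` of `δ_{n,N} - 1` times the polynomial part in the variable `t_n`. -/
def IsPolynomialPart (f : LaurentFrac Γ.Node) (P : Laurent Γ.Node) : Prop :=
  ∃ (P₁ : Γ.Node → Laurent Γ.Node) (P₂ : Sym2 Γ.Node → Laurent Γ.Node),
    (∀ n, IsPolynomialPartIn {n} f (P₁ n)) ∧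
    (∀ e ∈ Γ.orbGraph.edgeSet, IsPolynomialPartIn {n | n ∈ e} f (P₂ e)) ∧
    P = (∑ e ∈ Γ.orbGraph.edgeFinset, P₂ e) - ∑ n, ((Γ.orbValency n : ℤ) - 1) • P₁ n

/-- `n > n'`: there is an edge of the orbifold graph joining `n` and `n'`, and it is oriented from
`n` to `n'` if all edges are oriented towards the node `n₀`. -/
def OrientedEdge (n₀ n n' : Γ.Node) : Prop :=
  Γ.orbGraph.Adj n n' ∧ Γ.orbGraph.dist n' n₀ < Γ.orbGraph.dist n n₀

/-- The sign-function `𝔰_n`. -/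
def nodeSign (n : Γ.Node) (β : Γ.Node → ℚ) : ℤ := if 0 ≤ β n then 1 else 0

/-- The sign-function `𝔰_{n > n'}`. -/
def edgeSign (n n' : Γ.Node) (β : Γ.Node → ℚ) : ℤ := if 0 ≤ β n ∧ β n' < 0 then 1 else 0

open Classical in
/-- The multiplicity function `𝔰`, for the orientation towards the node `n₀`. -/
def multiplicity (n₀ : Γ.Node) (β : Γ.Node → ℚ) : ℤ :=
  Γ.nodeSign n₀ β +
    ∑ p : Γ.Node × Γ.Node with Γ.OrientedEdge n₀ p.1 p.2, Γ.edgeSign p.1 p.2 β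

end PlumbingTree

end

/-! Everything can be read off from one fraction. Some positive multiple of each `E_v^*` lies in
`L`, so multiplying by `∏ v, (1 - X v ^ k v) ^ 2` commutes with taking the part of class `h` and
clears the denominator of `Z`. Hence `f_h` has this product as a denominator. All entries of `-I⁻¹`
are positive (`dualVec_pos`), so after reduction this denominator has a strictly dominating exponent
with coefficient `±1` (`exists_isReducedZeta`), and a truncated geometric series performs the
division (`IsMonicTop.exists_division`).

For the quotient `Q`, the difference `f - Q = R / A` has negative degree in every variable at once.
Terms of `Q` that are negative in all directions of `S` may be moved into this difference, so each
polynomial part is obtained from `Q` by deleting terms (`IsDivisionQuotient.isPolynomialPartIn`).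
Uniqueness holds because a Laurent polynomial of negative degree in `t_n` has only exponents with `β
n < 0`.

What remains is a count for a single exponent `β`: the edges with a nonnegative end, minus the
nonnegative nodes weighted by `δ - 1`. The orbifold graph is a tree rooted at `n₀`
(`exists_isParent_orbGraph`), so every other node owns the edge to its parent. The contribution of
this edge collapses to `𝔰_{n > n'}`, leaving `𝔰_{n₀}` for the root (`sum_sign_eq_multiplicity`). -/

noncomputable section

/-! ### Supports, degrees and division of Laurent polynomials. -/

namespace Laurent

variable {N : Type*}

/-- All exponents of `P` lie in `s`. -/
def SuppIn (s : Set (N → ℚ)) (P : Laurent N) : Prop := ∀ β ∈ P.exponents, β ∈ s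

theorem mem_exponents {P : Laurent N} {β : N → ℚ} : β ∈ P.exponents ↔ P.coeff β ≠ 0 := by
  simp [exponents]

theorem SuppIn.mono {s t : Set (N → ℚ)} {P : Laurent N} (h : SuppIn s P) (hst : s ⊆ t) :
    SuppIn t P := fun β hβ => hst (h β hβ)

theorem suppIn_zero (s : Set (N → ℚ)) : SuppIn s (0 : Laurent N) := by
  intro β hβ
  simp [mem_exponents] at hβ

theorem SuppIn.add {s : Set (N → ℚ)} {P Q : Laurent N} (hP : SuppIn s P) (hQ : SuppIn s Q) :
    SuppIn s (P + Q) := by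
  intro β hβ
  by_contra hs
  have h1 : P.coeff β = 0 := by
    by_contra h; exact hs (hP β (mem_exponents.2 h))
  have h2 : Q.coeff β = 0 := by
    by_contra h; exact hs (hQ β (mem_exponents.2 h))
  simp [mem_exponents, h1, h2] at hβ

theorem SuppIn.neg {s : Set (N → ℚ)} {P : Laurent N} (hP : SuppIn s P) : SuppIn s (-P) := by
  intro β hβ
  refine hP β ?_
  simpa [mem_exponents] using hβ

theorem SuppIn.sub {s : Set (N → ℚ)} {P Q : Laurent N} (hP : SuppIn s P) (hQ : SuppIn s Q) :
    SuppIn s (P - Q) := by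
  rw [sub_eq_add_neg]
  exact hP.add hQ.neg

theorem SuppIn.mul {s t u : Set (N → ℚ)} {P Q : Laurent N} (hP : SuppIn s P) (hQ : SuppIn t Q)
    (h : ∀ x ∈ s, ∀ y ∈ t, x + y ∈ u) : SuppIn u (P * Q) := by
  classical
  intro β hβ
  obtain ⟨x, hx, y, hy, rfl⟩ :=
    Finset.mem_add.1 (AddMonoidAlgebra.support_coeff_mul_subset P Q hβ)
  exact h x (hP x hx) y (hQ y hy)

theorem suppIn_single {s : Set (N → ℚ)} {a : N → ℚ} (ha : a ∈ s) (r : ℤ) :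
    SuppIn s (AddMonoidAlgebra.single a r : Laurent N) := by
  intro β hβ
  rw [mem_exponents, AddMonoidAlgebra.coeff_single, Finsupp.single_apply_ne_zero] at hβ
  rw [hβ.1]
  exact ha

theorem suppIn_one {s : Set (N → ℚ)} (h : (0 : N → ℚ) ∈ s) : SuppIn s (1 : Laurent N) :=
  suppIn_single h 1

open Classical in
/-- The part of a Laurent polynomial consisting of the terms with exponent in `s`. -/
def part (s : Set (N → ℚ)) (P : Laurent N) : Laurent N :=
  AddMonoidAlgebra.ofCoeff (P.coeff.filter (· ∈ s))

open Classical in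
theorem coeff_part (s : Set (N → ℚ)) (P : Laurent N) (β : N → ℚ) :
    (part s P).coeff β = if β ∈ s then P.coeff β else 0 := by
  simp [part, Finsupp.filter_apply]

open Classical in
theorem coeff_part_compl (s : Set (N → ℚ)) (P : Laurent N) (β : N → ℚ) :
    (part sᶜ P).coeff β = (if β ∈ s then 0 else 1) * P.coeff β := by
  by_cases h : β ∈ s <;> simp [coeff_part, h]

theorem suppIn_part (s : Set (N → ℚ)) (P : Laurent N) : SuppIn s (part s P) := by
  intro β hβ
  by_contra h
  simp [mem_exponents, coeff_part, h] at hβ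

theorem mem_exponents_part {s : Set (N → ℚ)} {P : Laurent N} {β : N → ℚ} :
    β ∈ (part s P).exponents ↔ β ∈ s ∧ β ∈ P.exponents := by
  by_cases h : β ∈ s <;> simp [mem_exponents, coeff_part, h]

theorem part_add_part_compl (s : Set (N → ℚ)) (P : Laurent N) : part s P + part sᶜ P = P := by
  ext β
  by_cases h : β ∈ s <;> simp [coeff_part, h]

/-- The degree of `P` in the variable `t_n` is `c`. -/
def IsDeg (n : N) (c : ℚ) (P : Laurent N) : Prop :=
  ∃ T U : Laurent N, P = T + U ∧ T ≠ 0 ∧ SuppIn {β | β n = c} T ∧ SuppIn {β | β n < c} U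

theorem exponents_nonempty {P : Laurent N} (hP : P ≠ 0) : P.exponents.Nonempty := by
  simpa [exponents, Finsupp.support_nonempty_iff] using hP

theorem exists_isDeg (n : N) {P : Laurent N} (hP : P ≠ 0) : ∃ c, IsDeg n c P := by
  obtain ⟨m, hm, hmax⟩ := P.exponents.exists_max_image (fun β => β n) (exponents_nonempty hP)
  refine ⟨m n, part {β | β n = m n} P, part {β | β n = m n}ᶜ P,
    (part_add_part_compl _ _).symm, ?_, suppIn_part _ _, ?_⟩
  · intro h0
    have : m ∈ (part {β | β n = m n} P).exponents := mem_exponents_part.2 ⟨rfl, hm⟩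
    simp [h0, mem_exponents] at this
  · intro β hβ
    obtain ⟨h1, h2⟩ := mem_exponents_part.1 hβ
    exact lt_of_le_of_ne (hmax β h2) h1

theorem IsDeg.le {n : N} {c : ℚ} {P : Laurent N} (h : IsDeg n c P) :
    SuppIn {β | β n ≤ c} P := by
  obtain ⟨T, U, rfl, -, hT, hU⟩ := h
  exact (hT.mono fun _ hβ => le_of_eq (by exact hβ)).add (hU.mono fun _ hβ => le_of_lt (by exact hβ))

theorem IsDeg.exists_mem {n : N} {c : ℚ} {P : Laurent N} (h : IsDeg n c P) :
    ∃ β ∈ P.exponents, β n = c := by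
  obtain ⟨T, U, rfl, hT0, hT, hU⟩ := h
  obtain ⟨β, hβ⟩ := exponents_nonempty hT0
  have hc : β n = c := hT β hβ
  refine ⟨β, ?_, hc⟩
  have : U.coeff β = 0 := by
    by_contra h
    exact absurd hc (ne_of_lt (hU β (mem_exponents.2 h)))
  rw [mem_exponents] at hβ ⊢
  simpa [this] using hβ

theorem IsDeg.ne_zero {n : N} {c : ℚ} {P : Laurent N} (h : IsDeg n c P) : P ≠ 0 := by
  rintro rfl
  obtain ⟨β, hβ, -⟩ := h.exists_mem
  simp [mem_exponents] at hβ

/-- The product of the top parts does not vanish because Laurent polynomials form a domain. -/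
theorem IsDeg.mul {n : N} {c d : ℚ} {P Q : Laurent N} (hP : IsDeg n c P) (hQ : IsDeg n d Q) :
    IsDeg n (c + d) (P * Q) := by
  have hQ' := hQ.le
  obtain ⟨T, U, rfl, hT0, hT, hU⟩ := hP
  obtain ⟨T', U', rfl, hT0', hT', hU'⟩ := hQ
  refine ⟨T * T', T * U' + U * (T' + U'), by ring, mul_ne_zero hT0 hT0', ?_, ?_⟩
  · exact hT.mul hT' fun x hx y hy => by
      simp only [Set.mem_ofPred_eq, Pi.add_apply] at *
      linarith
  · refine (hT.mul hU' fun x hx y hy => ?_).add (hU.mul hQ' fun x hx y hy => ?_)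
    all_goals
      simp only [Set.mem_ofPred_eq, Pi.add_apply] at *
      linarith

/-- `A` has a unique maximal exponent `a`, whose coefficient is a unit: all the other exponents are
smaller in all coordinates. -/
def IsMonicTop (a : N → ℚ) (A : Laurent N) : Prop :=
  ∃ (u : ℤˣ) (U : Laurent N), A = AddMonoidAlgebra.single a (u : ℤ) + U ∧
    SuppIn {β | ∀ n, β n < a n} U

theorem IsMonicTop.mul {a b : N → ℚ} {A B : Laurent N} (hA : IsMonicTop a A)
    (hB : IsMonicTop b B) : IsMonicTop (a + b) (A * B) := by
  obtain ⟨u, U, rfl, hU⟩ := hA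
  obtain ⟨v, W, rfl, hW⟩ := hB
  refine ⟨u * v, AddMonoidAlgebra.single a (u : ℤ) * W + U * AddMonoidAlgebra.single b (v : ℤ)
    + U * W, ?_, ?_⟩
  · rw [Units.val_mul, ← AddMonoidAlgebra.single_mul_single]
    ring
  · refine (((suppIn_single (s := {a}) rfl _).mul hW ?_).add
      (hU.mul (suppIn_single (s := {b}) rfl _) ?_)).add (hU.mul hW ?_)
    · rintro x rfl y hy n
      simpa using hy n
    · rintro x hx y rfl n
      simpa using hx n
    · intro x hx y hy n
      exact add_lt_add (hx n) (hy n)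

theorem isMonicTop_one : IsMonicTop 0 (1 : Laurent N) :=
  ⟨1, 0, by simp [AddMonoidAlgebra.one_def], suppIn_zero _⟩

theorem isMonicTop_prod {ι : Type*} (s : Finset ι) (a : ι → N → ℚ) (A : ι → Laurent N)
    (h : ∀ i ∈ s, IsMonicTop (a i) (A i)) : IsMonicTop (∑ i ∈ s, a i) (∏ i ∈ s, A i) := by
  classical
  induction s using Finset.induction_on with
  | empty => simpa using isMonicTop_one
  | insert i s hi ih =>
    rw [Finset.sum_insert hi, Finset.prod_insert hi]
    exact (h i (by simp)).mul (ih fun j hj => h j (by simp [hj]))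

theorem isMonicTop_one_sub_single {a : N → ℚ} (ha : ∀ n, 0 < a n) :
    IsMonicTop a (1 - AddMonoidAlgebra.single a 1 : Laurent N) := by
  refine ⟨-1, 1, ?_, suppIn_one ha⟩
  have : AddMonoidAlgebra.single a (-1 : ℤ) = (-AddMonoidAlgebra.single a 1 : Laurent N) := by
    ext; simp
  simp only [Units.val_neg, Units.val_one, this]
  ring

/-- Without variables the bound on the lower terms is vacuous, and they could cancel the leading
one; hence `Nonempty N`. -/
theorem IsMonicTop.coeff_ne_zero [Nonempty N] {a : N → ℚ} {A : Laurent N} (h : IsMonicTop a A) :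
    A.coeff a ≠ 0 := by
  obtain ⟨u, U, rfl, hU⟩ := h
  have : U.coeff a = 0 := by
    by_contra h
    exact lt_irrefl _ (hU a (mem_exponents.2 h) (Classical.arbitrary N))
  simp [this]

theorem IsMonicTop.lt {a : N → ℚ} {A : Laurent N} (h : IsMonicTop a A) :
    ∀ b ∈ A.exponents, b ≠ a → ∀ n, b n < a n := by
  obtain ⟨u, U, rfl, hU⟩ := h
  intro b hb hba
  refine hU b ?_
  rw [mem_exponents] at hb ⊢
  simpa [Finsupp.single_apply, Ne.symm hba] using hb

theorem isDeg_of_top {a : N → ℚ} {A : Laurent N} (ha : a ∈ A.exponents)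
    (h : ∀ b ∈ A.exponents, b ≠ a → ∀ n, b n < a n) (n : N) : IsDeg n (a n) A := by
  refine ⟨part {a} A, part {a}ᶜ A, (part_add_part_compl _ _).symm, fun h0 => ?_,
    (suppIn_part {a} A).mono ?_, ?_⟩
  · have : a ∈ (part {a} A).exponents := mem_exponents_part.2 ⟨rfl, ha⟩
    simp [h0, mem_exponents] at this
  · rintro β rfl
    rfl
  · intro β hβ
    obtain ⟨h1, h2⟩ := mem_exponents_part.1 hβ
    exact h β h2 h1 n

theorem SuppIn.pow_le {v : Laurent N} {ε : ℚ} (h : SuppIn {β | ∀ n, β n ≤ -ε} v) (k : ℕ) :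
    SuppIn {β | ∀ n, β n ≤ -(k * ε)} (v ^ k) := by
  induction k with
  | zero => simpa using suppIn_one (N := N) (s := {β | ∀ n, β n ≤ 0}) fun _ => le_rfl
  | succ k ih =>
    rw [pow_succ]
    refine ih.mul h fun x hx y hy n => ?_
    have := hx n
    have := hy n
    simp only [Pi.add_apply]
    push_cast
    linarith

theorem exists_suppIn_le_neg [Finite N] {v : Laurent N} (h : SuppIn {β | ∀ n, β n < 0} v) :
    ∃ ε : ℚ, 0 < ε ∧ SuppIn {β | ∀ n, β n ≤ -ε} v := by
  cases nonempty_fintype N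
  rcases (v.exponents ×ˢ (Finset.univ : Finset N)).eq_empty_or_nonempty with h0 | hne
  · refine ⟨1, one_pos, fun β hβ n => ?_⟩
    have : (β, n) ∈ v.exponents ×ˢ (Finset.univ : Finset N) := by simp [hβ]
    simp [h0] at this
  · obtain ⟨p, hp, hmax⟩ := Finset.exists_max_image _ (fun p : (N → ℚ) × N => p.1 p.2) hne
    refine ⟨-p.1 p.2, ?_, fun β hβ n => ?_⟩
    · have := h p.1 (Finset.mem_product.1 hp).1 p.2
      linarith
    · have := hmax (β, n) (by simp [hβ])
      simpa using this

theorem exists_suppIn_le [Finite N] (B : Laurent N) : ∃ M : ℚ, SuppIn {β | ∀ n, β n ≤ M} B := by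
  cases nonempty_fintype N
  obtain ⟨M, hM⟩ := Finset.exists_le
    ((B.exponents ×ˢ (Finset.univ : Finset N)).image fun p => p.1 p.2)
  refine ⟨M, fun β hβ n => hM _ ?_⟩
  exact Finset.mem_image.2 ⟨(β, n), by simp [hβ], rfl⟩

/-- With `w` the inverse of the leading term, `w * A = 1 - v` where `v` has only negative exponents.
Thus `B / A` is `B * w` times the geometric series in `v`, which can be cut off once `B * v ^ k` is
small enough to be a remainder. -/
theorem IsMonicTop.exists_division [Finite N] {a : N → ℚ} {A : Laurent N} (hA : IsMonicTop a A)
    (ha : ∀ n, 0 < a n) (B : Laurent N) :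
    ∃ Q R : Laurent N, B = Q * A + R ∧ (∀ β ∈ Q.exponents, ¬ ∀ n, β n < 0) ∧
      ∀ ρ ∈ R.exponents, ∀ n, ρ n < a n := by
  obtain ⟨u, U, rfl, hU⟩ := hA
  set w : Laurent N := AddMonoidAlgebra.single (-a) ((u⁻¹ : ℤˣ) : ℤ) with hw
  have hwu : w * AddMonoidAlgebra.single a (u : ℤ) = 1 := by
    rw [hw, AddMonoidAlgebra.single_mul_single, neg_add_cancel, Units.inv_mul]
    rfl
  set v : Laurent N := -(w * U) with hv
  have hvneg : SuppIn {β | ∀ n, β n < 0} v := by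
    refine SuppIn.neg ((suppIn_single (s := {-a}) rfl _).mul hU ?_)
    rintro x rfl y hy n
    have := hy n
    simp only [Pi.add_apply, Pi.neg_apply]
    linarith
  obtain ⟨ε, hε, hve⟩ := exists_suppIn_le_neg hvneg
  obtain ⟨M, hM⟩ := exists_suppIn_le B
  obtain ⟨k, hk⟩ := exists_nat_gt (M / ε)
  have hk' : M < k * ε := by rwa [div_lt_iff₀ hε] at hk
  have hB : SuppIn {β | ∀ n, β n < a n} (B * v ^ k) := by
    refine hM.mul (hve.pow_le k) fun x hx y hy n => ?_
    have h1 := hx n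
    have h2 := hy n
    have h3 := ha n
    simp only [Pi.add_apply]
    linarith
  set A : Laurent N := AddMonoidAlgebra.single a (u : ℤ) + U with hA
  have hwA : w * A = 1 - v := by rw [hA, mul_add, hwu, hv]; ring
  set Q₀ : Laurent N := B * (∑ i ∈ Finset.range k, v ^ i) * w with hQ₀
  have hdiv : B = Q₀ * A + B * v ^ k := by
    have := mul_neg_geom_sum v k
    calc B = B * (1 - v ^ k) + B * v ^ k := by ring
      _ = B * ((1 - v) * ∑ i ∈ Finset.range k, v ^ i) + B * v ^ k := by rw [this]
      _ = B * (w * A * ∑ i ∈ Finset.range k, v ^ i) + B * v ^ k := by rw [hwA]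
      _ = _ := by rw [hQ₀]; ring
  set s : Set (N → ℚ) := {β | ∀ n, β n < 0} with hs
  -- Terms of `Q₀` negative in all directions are not allowed in the quotient; times `A` they stay
  -- below `a`, so they join the remainder.
  refine ⟨part sᶜ Q₀, part s Q₀ * A + B * v ^ k, ?_, suppIn_part sᶜ Q₀, ?_⟩
  · conv_lhs => rw [hdiv, ← part_add_part_compl s Q₀]
    ring
  · refine SuppIn.add ((suppIn_part s Q₀).mul (t := {β | ∀ n, β n ≤ a n}) ?_ ?_) hB
    · exact (suppIn_single (s := {β | ∀ n, β n ≤ a n}) (fun n => le_rfl) _).add (hU.mono fun β hβ n => (hβ n).le)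
    · intro x hx y hy n
      have h1 := hx n
      have h2 := hy n
      simp only [Pi.add_apply]
      linarith

end Laurent

/-! ### Negative degree, polynomial parts and the division quotient. -/

section NegDegree

open Laurent

variable {N : Type*}

theorem HasNegDegree.exists_isDeg {n : N} {g : LaurentFrac N} (h : HasNegDegree n g) :
    ∃ (R A : Laurent N) (c : ℚ), IsDeg n c A ∧ SuppIn {β | β n < c} R ∧
      g = algebraMap (Laurent N) (LaurentFrac N) R / algebraMap (Laurent N) (LaurentFrac N) A := by
  obtain ⟨R, A, hA, hg, a, ha, hR⟩ := h
  obtain ⟨c, hc⟩ := Laurent.exists_isDeg n hA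
  exact ⟨R, A, c, hc, fun β hβ => lt_of_lt_of_le (hR β hβ) (hc.le a ha), hg⟩

theorem hasNegDegree_of_isDeg {n : N} {R A : Laurent N} {c : ℚ} (hA : IsDeg n c A)
    (hR : SuppIn {β | β n < c} R) :
    HasNegDegree n (algebraMap (Laurent N) (LaurentFrac N) R / algebraMap _ _ A) := by
  obtain ⟨a, ha, hac⟩ := hA.exists_mem
  exact ⟨R, A, hA.ne_zero, rfl, a, ha, fun r hr => hac ▸ hR r hr⟩

theorem algebraMap_laurentFrac_ne_zero {A : Laurent N} (hA : A ≠ 0) :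
    algebraMap (Laurent N) (LaurentFrac N) A ≠ 0 :=
  (map_ne_zero_iff _ (IsFractionRing.injective (Laurent N) (LaurentFrac N))).2 hA

theorem HasNegDegree.sub {n : N} {g g' : LaurentFrac N} (h : HasNegDegree n g)
    (h' : HasNegDegree n g') : HasNegDegree n (g - g') := by
  obtain ⟨R, A, c, hA, hR, rfl⟩ := h.exists_isDeg
  obtain ⟨R', A', c', hA', hR', rfl⟩ := h'.exists_isDeg
  rw [div_sub_div _ _ (algebraMap_laurentFrac_ne_zero hA.ne_zero)
    (algebraMap_laurentFrac_ne_zero hA'.ne_zero), ← map_mul, ← map_mul, ← map_mul, ← map_sub]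
  refine hasNegDegree_of_isDeg (hA.mul hA') ((hR.mul hA'.le ?_).sub (hA.le.mul hR' ?_))
  all_goals
    intro x hx y hy
    simp only [Set.mem_ofPred_eq, Pi.add_apply] at *
    linarith

/-- From `D = R / A` follows `D * A = R`, and degrees in `t_n` add, so the degree of `D` is
negative. This makes the notion independent of the chosen fraction and underlies all uniqueness
claims. -/
theorem HasNegDegree.suppIn {n : N} {D : Laurent N}
    (h : HasNegDegree n (algebraMap (Laurent N) (LaurentFrac N) D)) :
    SuppIn {β | β n < 0} D := by
  obtain ⟨R, A, c, hA, hR, hD⟩ := h.exists_isDeg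
  rw [eq_div_iff (algebraMap_laurentFrac_ne_zero hA.ne_zero), ← map_mul] at hD
  replace hD := IsFractionRing.injective (Laurent N) (LaurentFrac N) hD
  rcases eq_or_ne D 0 with rfl | hD0
  · exact suppIn_zero _
  obtain ⟨d, hd⟩ := Laurent.exists_isDeg n hD0
  obtain ⟨β, hβ, hβd⟩ := (hd.mul hA).exists_mem
  rw [hD] at hβ
  have h1 : β n < c := hR β hβ
  refine hd.le.mono fun γ hγ => ?_
  simp only [Set.mem_ofPred_eq] at *
  linarith

theorem hasNegDegree_algebraMap {n : N} {D : Laurent N} (h : SuppIn {β | β n < 0} D) :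
    HasNegDegree n (algebraMap (Laurent N) (LaurentFrac N) D) := by
  have h1 : IsDeg n 0 (1 : Laurent N) :=
    ⟨1, 0, by simp, one_ne_zero, suppIn_one rfl, suppIn_zero _⟩
  simpa using hasNegDegree_of_isDeg h1 h

theorem HasNegDegree.add {n : N} {g g' : LaurentFrac N} (h : HasNegDegree n g)
    (h' : HasNegDegree n g') : HasNegDegree n (g + g') := by
  have h0 : HasNegDegree n (0 : LaurentFrac N) := by
    simpa using hasNegDegree_algebraMap (suppIn_zero (N := N) {β | β n < 0})
  simpa using h.sub (h0.sub h')

/-- The exponents of `P - P'` are negative in every direction of `S` by the degree condition, and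
not so by the support condition; hence there are none. -/
theorem IsPolynomialPartIn.unique {S : Set N} {f : LaurentFrac N} {P P' : Laurent N}
    (h : IsPolynomialPartIn S f P) (h' : IsPolynomialPartIn S f P') : P = P' := by
  have hneg : ∀ n ∈ S, SuppIn {β | β n < 0} (P - P') := fun n hn => by
    refine HasNegDegree.suppIn ?_
    have := (h'.2 n hn).sub (h.2 n hn)
    rwa [sub_sub_sub_cancel_left, ← map_sub] at this
  have hS : SuppIn {β | ¬ ∀ n ∈ S, β n < 0} (P - P') := SuppIn.sub h.1 h'.1
  by_contra hne
  obtain ⟨β, hβ⟩ := exponents_nonempty (sub_ne_zero.2 hne)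
  exact hS β hβ fun n hn => hneg n hn β hβ

theorem IsDivisionQuotient.hasNegDegree {f : LaurentFrac N} {Q : Laurent N}
    (h : IsDivisionQuotient f Q) (n : N) :
    HasNegDegree n (f - algebraMap (Laurent N) (LaurentFrac N) Q) := by
  obtain ⟨A, B, R, a, ha, hA, -, rfl, rfl, -, hR⟩ := h
  have hdeg := isDeg_of_top ha hA n
  have h0 := algebraMap_laurentFrac_ne_zero hdeg.ne_zero
  rw [map_add, map_mul, add_div, mul_div_cancel_right₀ _ h0, add_sub_cancel_left]
  exact hasNegDegree_of_isDeg hdeg fun β hβ => hR β hβ n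

theorem IsDivisionQuotient.unique {f : LaurentFrac N} {Q Q' : Laurent N}
    (h : IsDivisionQuotient f Q) (h' : IsDivisionQuotient f Q') : Q = Q' := by
  -- A quotient is the polynomial part in all variables, a description that does not involve `A` and
  -- `B`.
  have key : ∀ {Q : Laurent N}, IsDivisionQuotient f Q → IsPolynomialPartIn Set.univ f Q := by
    intro Q h
    refine ⟨?_, fun n _ => h.hasNegDegree n⟩
    obtain ⟨A, B, R, a, -, -, -, -, -, hQ, -⟩ := h
    simpa using hQ
  exact (key h).unique (key h')

/-- The polynomial part in the variables `t_n`, `n ∈ S`, consists of the terms of the quotient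
whose exponents are not negative in all directions of `S`. -/
theorem IsDivisionQuotient.isPolynomialPartIn {f : LaurentFrac N} {Q : Laurent N}
    (h : IsDivisionQuotient f Q) (S : Set N) :
    IsPolynomialPartIn S f (part {β | ∀ n ∈ S, β n < 0}ᶜ Q) := by
  refine ⟨suppIn_part _ Q, fun n hn => ?_⟩
  have h1 : HasNegDegree n (algebraMap (Laurent N) (LaurentFrac N)
      (part {β | ∀ n ∈ S, β n < 0} Q)) :=
    hasNegDegree_algebraMap ((suppIn_part _ Q).mono fun β hβ => hβ n hn)
  have h2 := (h.hasNegDegree n).add h1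
  have h3 : algebraMap (Laurent N) (LaurentFrac N) Q = algebraMap _ _ _ + algebraMap _ _ _ :=
    (congrArg _ (part_add_part_compl {β | ∀ n ∈ S, β n < 0} Q).symm).trans (map_add _ _ _)
  rw [h3] at h2
  convert h2 using 1
  ring

theorem Laurent.IsMonicTop.exists_isDivisionQuotient [Finite N] [Nonempty N] {a : N → ℚ}
    {A : Laurent N} (hA : IsMonicTop a A) (ha : ∀ n, 0 < a n) (B : Laurent N) :
    ∃ Q : Laurent N, IsDivisionQuotient
      (algebraMap (Laurent N) (LaurentFrac N) B / algebraMap (Laurent N) (LaurentFrac N) A) Q := by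
  obtain ⟨Q, R, hB, hQ, hR⟩ := hA.exists_division ha B
  exact ⟨Q, A, B, R, a, mem_exponents.2 hA.coeff_ne_zero, hA.lt, ha, rfl, hB, hQ, hR⟩

end NegDegree
end

/-! ### Positivity of `-I⁻¹` and the reduced zeta-function. -/

noncomputable section

namespace PlumbingTree

variable {V : Type*} [Fintype V] (Γ : PlumbingTree V)

open Classical in
theorem plumbingMatrix_mulVec_dualVec (v : V) :
    (plumbingMatrix Γ.graph Γ.euler).mulVec (Γ.dualVec v) = -Pi.single v 1 := by
  have hu : IsUnit (plumbingMatrix Γ.graph Γ.euler).det := (Γ.det_ne_zero).isUnit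
  rw [dualVec, Matrix.mulVec_neg, Matrix.mulVec_mulVec, Matrix.mul_nonsing_inv _ hu,
    Matrix.one_mulVec]

theorem plumbingMatrix_nonneg_of_ne {v w : V} (h : v ≠ w) :
    0 ≤ plumbingMatrix Γ.graph Γ.euler v w := by
  simp only [plumbingMatrix, Matrix.of_apply, if_neg h]
  split_ifs <;> norm_num

/-- Split `x = E_v^*` into positive and negative parts `p - q`. Their supports are disjoint and
off-diagonal entries are nonnegative, so `(q, p) ≥ 0`. If `q ≠ 0`, then `(q, x) = (q, p) - (q, q) >
0`, contradicting `(q, x) = -q v ≤ 0`. -/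
theorem dualVec_nonneg (v w : V) : 0 ≤ Γ.dualVec v w := by
  classical
  set x := Γ.dualVec v with hx
  set M := plumbingMatrix Γ.graph Γ.euler with hM
  set p : V → ℚ := fun w => max (x w) 0 with hp
  set q : V → ℚ := fun w => max (-x w) 0 with hq
  have hxpq : x = p - q := by
    ext w
    simp only [hp, hq, Pi.sub_apply]
    rcases le_total (x w) 0 with h | h
    · rw [max_eq_right h, max_eq_left (by linarith)]; ring
    · rw [max_eq_left h, max_eq_right (by linarith)]; ring
  have h1 : q ⬝ᵥ M.mulVec x = -q v := by
    rw [hx, hM, plumbingMatrix_mulVec_dualVec, dotProduct_neg, dotProduct_single, mul_one]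
  have h2 : 0 ≤ q ⬝ᵥ M.mulVec p := by
    simp only [dotProduct, Matrix.mulVec, Finset.mul_sum]
    refine Finset.sum_nonneg fun u _ => Finset.sum_nonneg fun w _ => ?_
    by_cases huw : u = w
    · subst huw
      have : q u * p u = 0 := by
        simp only [hp, hq]
        rcases le_total (x u) 0 with h | h
        · rw [max_eq_right h]; ring
        · rw [max_eq_right (a := -x u) (by linarith)]; ring
      rw [mul_left_comm, this, mul_zero]
    · exact mul_nonneg (le_max_right _ _)
        (mul_nonneg (Γ.plumbingMatrix_nonneg_of_ne huw) (le_max_right _ _))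
  have h3 : q ⬝ᵥ M.mulVec x = q ⬝ᵥ M.mulVec p - q ⬝ᵥ M.mulVec q := by
    rw [hxpq, Matrix.mulVec_sub, dotProduct_sub]
  have hqv : 0 ≤ q v := le_max_right _ _
  have h0 : q = 0 := by
    by_contra hne
    have := Γ.negDef q hne
    linarith
  have := congrFun h0 w
  simp only [hq, Pi.zero_apply] at this
  have := le_max_left (-x w) 0
  linarith

/-- If the coordinate at `u` is zero, then `(E_v^*, E_u)` is a sum of nonnegative terms, yet it is
at most `0`; so every neighbour has coordinate zero. -/
theorem dualVec_eq_zero_of_adj {v u w : V} (hu : Γ.dualVec v u = 0) (h : Γ.graph.Adj u w) :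
    Γ.dualVec v w = 0 := by
  classical
  set M := plumbingMatrix Γ.graph Γ.euler with hM
  have hnn : ∀ i, 0 ≤ M u i * Γ.dualVec v i := fun i => by
    by_cases hi : u = i
    · rw [← hi, hu, mul_zero]
    · exact mul_nonneg (Γ.plumbingMatrix_nonneg_of_ne hi) (Γ.dualVec_nonneg v i)
  have hsum : ∑ i, M u i * Γ.dualVec v i = -(Pi.single v 1 : V → ℚ) u :=
    congrFun (Γ.plumbingMatrix_mulVec_dualVec v) u
  have hle : ∑ i, M u i * Γ.dualVec v i ≤ 0 := by
    have : 0 ≤ (Pi.single v 1 : V → ℚ) u := by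
      rw [Pi.single_apply]; split_ifs <;> norm_num
    linarith
  have := (Finset.sum_eq_zero_iff_of_nonneg fun i _ => hnn i).1
    (le_antisymm hle (Finset.sum_nonneg fun i _ => hnn i)) w (Finset.mem_univ w)
  have hMuw : M u w = 1 := by
    simp [hM, plumbingMatrix, h.ne, h]
  rwa [hMuw, one_mul] at this

/-- All the entries of `-I⁻¹` are positive. -/
theorem dualVec_pos (v w : V) : 0 < Γ.dualVec v w := by
  classical
  refine lt_of_le_of_ne (Γ.dualVec_nonneg v w) fun h0 => ?_
  have hall : ∀ u, Γ.dualVec v u = 0 := fun u => by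
    obtain ⟨p⟩ := Γ.isTree.connected w u
    have h0' := h0.symm
    clear h0
    induction p with
    | nil => exact h0'
    | cons hadj _ ih => exact ih (Γ.dualVec_eq_zero_of_adj h0' hadj)
  have h1 := congrFun (Γ.plumbingMatrix_mulVec_dualVec v) v
  rw [show Γ.dualVec v = 0 from funext hall, Matrix.mulVec_zero] at h1
  simp at h1

theorem expClass_add (m m' : V →₀ ℕ) : Γ.expClass (m + m') = Γ.expClass m + Γ.expClass m' := by
  simp only [expClass, Finsupp.add_apply, add_smul, Finset.sum_add_distrib, QuotientAddGroup.mk_add]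

theorem exists_expClass_single_eq_zero (v : V) :
    ∃ k : ℕ, 0 < k ∧ Γ.expClass (Finsupp.single v k) = 0 := by
  classical
  -- A common denominator of the coordinates of `E_v^*`.
  refine ⟨∏ w, (Γ.dualVec v w).den, Finset.prod_pos fun w _ => (Γ.dualVec v w).den_pos, ?_⟩
  rw [expClass, QuotientAddGroup.eq_zero_iff, AddSubgroup.mem_addSubgroupOf]
  intro w
  obtain ⟨c, hc⟩ := Finset.dvd_prod_of_mem (fun w => (Γ.dualVec v w).den) (Finset.mem_univ w)
  refine ⟨c * (Γ.dualVec v w).num, ?_⟩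
  rw [Finset.sum_eq_single v (fun u _ hu => by simp [hu.symm])
    (fun h => absurd (Finset.mem_univ v) h), Finsupp.single_eq_same, hc, AddSubgroup.coe_nsmul,
    Pi.smul_apply, nsmul_eq_mul]
  have h1 : (Γ.dualVec v w) * (Γ.dualVec v w).den = (Γ.dualVec v w).num := Rat.mul_den_eq_num _
  change _ * Γ.dualVec v w = _
  push_cast
  rw [← h1]
  ring

open Classical in
/-- The sum of the terms of a power series whose exponents are of class `h`. -/
def classPart (h : Γ.H) (F : MvPowerSeries V ℤ) : MvPowerSeries V ℤ :=
  fun m => if Γ.expClass m = h then MvPowerSeries.coeff m F else 0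

open Classical in
theorem coeff_classPart (h : Γ.H) (F : MvPowerSeries V ℤ) (m : V →₀ ℕ) :
    MvPowerSeries.coeff m (Γ.classPart h F) =
      if Γ.expClass m = h then MvPowerSeries.coeff m F else 0 := rfl

open Classical in
theorem exists_coe_eq_classPart (h : Γ.H) (B : MvPolynomial V ℤ) :
    ∃ C : MvPolynomial V ℤ, (C : MvPowerSeries V ℤ) = Γ.classPart h B := by
  refine ⟨∑ m ∈ B.support with Γ.expClass m = h, MvPolynomial.monomial m (B.coeff m), ?_⟩
  ext m
  rw [coeff_classPart, MvPolynomial.coeff_coe, MvPolynomial.coeff_coe, MvPolynomial.coeff_sum]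
  simp only [MvPolynomial.coeff_monomial, Finset.sum_ite_eq', Finset.mem_filter,
    MvPolynomial.mem_support_iff]
  by_cases h0 : B.coeff m = 0 <;> simp [h0]

/-- Multiplication by a monomial of trivial class does not change the class of a term. -/
theorem one_sub_X_pow_mul_classPart (h : Γ.H) {v : V} {k : ℕ}
    (hk : Γ.expClass (Finsupp.single v k) = 0) (F : MvPowerSeries V ℤ) :
    (1 - MvPowerSeries.X v ^ k) * Γ.classPart h F =
      Γ.classPart h ((1 - MvPowerSeries.X v ^ k) * F) := by
  classical
  ext m
  rw [coeff_classPart, sub_mul, sub_mul, one_mul, one_mul, map_sub, map_sub, coeff_classPart,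
    MvPowerSeries.X_pow_eq, MvPowerSeries.coeff_monomial_mul, MvPowerSeries.coeff_monomial_mul,
    coeff_classPart]
  by_cases hm : Finsupp.single v k ≤ m
  · have : Γ.expClass m = Γ.expClass (m - Finsupp.single v k) := by
      conv_lhs => rw [← tsub_add_cancel_of_le hm]
      rw [expClass_add, hk, add_zero]
    rw [if_pos hm, if_pos hm, this]
    split_ifs <;> simp
  · rw [if_neg hm, if_neg hm]
    split_ifs <;> simp

theorem prod_one_sub_X_pow_mul_classPart (h : Γ.H) {k : V → ℕ}
    (hk : ∀ v, Γ.expClass (Finsupp.single v (k v)) = 0) (s : Finset V) (F : MvPowerSeries V ℤ) :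
    (∏ v ∈ s, (1 - MvPowerSeries.X v ^ k v) ^ 2) * Γ.classPart h F =
      Γ.classPart h ((∏ v ∈ s, (1 - MvPowerSeries.X v ^ k v) ^ 2) * F) := by
  classical
  induction s using Finset.induction_on generalizing F with
  | empty => simp
  | insert v s hv ih =>
    rw [Finset.prod_insert hv, mul_assoc, ih, pow_two, mul_assoc,
      Γ.one_sub_X_pow_mul_classPart h (hk v), Γ.one_sub_X_pow_mul_classPart h (hk v)]
    simp only [mul_assoc]

/-- Cross-multiplication before reduction: `B * A'` and `B' * A` both equal `A * A' * Z_h` as power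
series. -/
theorem IsReducedZeta.unique {h : Γ.H} {f f' : LaurentFrac Γ.Node} (hf : Γ.IsReducedZeta h f)
    (hf' : Γ.IsReducedZeta h f') : f = f' := by
  obtain ⟨A, B, hAB, hA, rfl⟩ := hf
  obtain ⟨A', B', hAB', hA', rfl⟩ := hf'
  have h1 : B * A' = B' * A := by
    apply MvPolynomial.coe_injective
    rw [MvPolynomial.coe_mul, MvPolynomial.coe_mul, ← hAB, ← hAB']
    ring
  rw [div_eq_div_iff (algebraMap_laurentFrac_ne_zero hA) (algebraMap_laurentFrac_ne_zero hA'),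
    ← map_mul, ← map_mul, ← map_mul, ← map_mul, h1]

theorem exists_isReducedZeta (h : Γ.H) (n₀ : Γ.Node) :
    ∃ (A B : Laurent Γ.Node) (a : Γ.Node → ℚ), Laurent.IsMonicTop a A ∧ (∀ n, 0 < a n) ∧
      Γ.IsReducedZeta h (algebraMap (Laurent Γ.Node) (LaurentFrac Γ.Node) B /
        algebraMap (Laurent Γ.Node) (LaurentFrac Γ.Node) A) := by
  choose k hk0 hk using Γ.exists_expClass_single_eq_zero
  -- The exponent `2` bounds `2 - δ_v` for every valency, so `zetaDen` divides `A`.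
  set A : MvPolynomial V ℤ := ∏ v, (1 - MvPolynomial.X v ^ k v) ^ 2 with hA
  obtain ⟨C, hC⟩ : Γ.zetaDen ∣ A := by
    refine Finset.prod_dvd_prod_of_dvd _ _ fun v _ => ?_
    refine (pow_dvd_pow _ (Nat.sub_le 2 _)).trans (pow_dvd_pow_of_dvd ?_ 2)
    simpa using sub_dvd_pow_sub_pow (1 : MvPolynomial V ℤ) (MvPolynomial.X v) (k v)
  have hAcoe : (A : MvPowerSeries V ℤ) = ∏ v, (1 - MvPowerSeries.X v ^ k v) ^ 2 := by
    have hX (v : V) : MvPolynomial.coeToMvPowerSeries.ringHom (MvPolynomial.X v) =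
        (MvPowerSeries.X v : MvPowerSeries V ℤ) := MvPolynomial.coe_X v
    rw [hA, ← MvPolynomial.coeToMvPowerSeries.ringHom_apply]
    simp only [map_prod, map_pow, map_sub, map_one, hX]
  obtain ⟨B, hB⟩ := Γ.exists_coe_eq_classPart h (C * Γ.zetaNum)
  have hAB : (A : MvPowerSeries V ℤ) * Γ.poincareSeriesPart h = (B : MvPowerSeries V ℤ) := by
    have h1 : Γ.poincareSeriesPart h = Γ.classPart h Γ.poincareSeries := rfl
    rw [hB, h1, hAcoe, prod_one_sub_X_pow_mul_classPart Γ h hk, ← hAcoe, hC, MvPolynomial.coe_mul,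
      MvPolynomial.coe_mul, ← zetaDen_mul_poincareSeries]
    congr 1
    ring
  set α : V → Γ.Node → ℚ := fun v => k v • fun n : Γ.Node => Γ.dualVec v n with hα
  have hαpos : ∀ v n, 0 < α v n := fun v n => by
    rw [hα]
    exact nsmul_pos (Γ.dualVec_pos v n) (hk0 v).ne'
  have hred : Γ.reduce A = ∏ v, (1 - AddMonoidAlgebra.single (α v) 1) ^ 2 := by
    rw [hA, map_prod]
    refine Finset.prod_congr rfl fun v _ => ?_
    rw [map_pow, map_sub, map_one, map_pow, reduce, MvPolynomial.aeval_X,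
      AddMonoidAlgebra.single_pow, one_pow]
    rfl
  have htop : Laurent.IsMonicTop (∑ v, (α v + α v)) (Γ.reduce A) := by
    rw [hred]
    refine Laurent.isMonicTop_prod _ _ _ fun v _ => ?_
    rw [pow_two]
    exact (Laurent.isMonicTop_one_sub_single (hαpos v)).mul
      (Laurent.isMonicTop_one_sub_single (hαpos v))
  have : Nonempty Γ.Node := ⟨n₀⟩
  refine ⟨Γ.reduce A, Γ.reduce B, _, htop, fun n => ?_, A, B, hAB, fun h0 => ?_, rfl⟩
  · rw [Finset.sum_apply]
    exact Finset.sum_pos (fun v _ => add_pos (hαpos v n) (hαpos v n)) ⟨n₀, Finset.mem_univ _⟩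
  · exact htop.coeff_ne_zero (by simp [h0])

end PlumbingTree
end

noncomputable section

/-! ### Graphs described by a root and a parent function. -/

section RootedGraph

variable {N : Type*} {G : SimpleGraph N} {r : N} {up : N → N}

/-- `up` is a parent function of the graph `G` with root `r`. -/
structure SimpleGraph.IsParent (G : SimpleGraph N) (r : N) (up : N → N) : Prop where
  adj_iff : ∀ n m, G.Adj n m ↔ (n ≠ r ∧ up n = m) ∨ (m ≠ r ∧ up m = n)
  reachable : ∀ n, G.Reachable n r

namespace SimpleGraph.IsParent

theorem adj_up (h : G.IsParent r up) {n : N} (hn : n ≠ r) : G.Adj n (up n) :=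
  (h.adj_iff _ _).2 (Or.inl ⟨hn, rfl⟩)

/-- Induction on the walk. If its first step goes to the parent, the rest is the bound. If it goes
to a child, the rest is already longer than the distance from `n`, and the parent is at most one
further away. -/
theorem dist_up_lt_length (h : G.IsParent r up) {n : N} (hn : n ≠ r) (w : G.Walk n r) :
    G.dist (up n) r < w.length := by
  induction w with
  | nil => exact absurd rfl hn
  | @cons u v r hadj w ih =>
    rw [SimpleGraph.Walk.length_cons, Nat.lt_succ_iff]
    rcases (h.adj_iff _ _).1 hadj with ⟨-, hm⟩ | ⟨hm, hmn⟩
    · rw [hm]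
      exact SimpleGraph.dist_le w
    · have h1 := ih h hm
      rw [hmn] at h1
      have h2 := (h.adj_up hn).symm.reachable.dist_triangle_left r
      rw [SimpleGraph.dist_eq_one_iff_adj.2 (h.adj_up hn).symm] at h2
      omega

theorem dist_up_lt (h : G.IsParent r up) {n : N} (hn : n ≠ r) :
    G.dist (up n) r < G.dist n r := by
  obtain ⟨w, hw⟩ := (h.reachable n).exists_walk_length_eq_dist
  rw [← hw]
  exact h.dist_up_lt_length hn w

theorem adj_and_dist_lt_iff (h : G.IsParent r up) (n m : N) :
    G.Adj n m ∧ G.dist m r < G.dist n r ↔ n ≠ r ∧ up n = m := by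
  constructor
  · rintro ⟨h1, h2⟩
    rcases (h.adj_iff _ _).1 h1 with h3 | ⟨h3, rfl⟩
    · exact h3
    · exact absurd h2 (h.dist_up_lt h3).le.not_gt
  · rintro ⟨hn, rfl⟩
    exact ⟨h.adj_up hn, h.dist_up_lt hn⟩

variable [Fintype N] [DecidableEq N]

theorem sum_edgeFinset [Fintype G.edgeSet] (h : G.IsParent r up) {M : Type*} [AddCommMonoid M]
    (g : Sym2 N → M) : ∑ e ∈ G.edgeFinset, g e = ∑ n with n ≠ r, g s(n, up n) := by
  symm
  refine Finset.sum_bij (fun n _ => s(n, up n)) ?_ ?_ ?_ fun _ _ => rfl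
  · intro n hn
    rw [SimpleGraph.mem_edgeFinset, SimpleGraph.mem_edgeSet]
    exact h.adj_up (Finset.mem_filter.1 hn).2
  · intro n hn m hm hnm
    rcases Sym2.eq_iff.1 hnm with ⟨h1, -⟩ | ⟨h1, h2⟩
    · exact h1
    -- Two nodes cannot be parents of each other, since the distance to the root drops strictly.
    · have h3 := h.dist_up_lt (Finset.mem_filter.1 hn).2
      have h4 := h.dist_up_lt (Finset.mem_filter.1 hm).2
      rw [h2] at h3
      rw [← h1] at h4
      omega
  · intro e he
    induction e with
    | _ n m =>
      rw [SimpleGraph.mem_edgeFinset, SimpleGraph.mem_edgeSet, h.adj_iff] at he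
      rcases he with ⟨hn, rfl⟩ | ⟨hm, rfl⟩
      · exact ⟨n, by simpa using hn, rfl⟩
      · exact ⟨m, by simpa using hm, Sym2.eq_swap⟩

/-- Handshake count: each edge, indexed by its child, contributes the values at both ends. -/
theorem sum_ncard_neighborSet_mul (h : G.IsParent r up) (s : N → ℤ) :
    ∑ n, ((G.neighborSet n).ncard : ℤ) * s n = ∑ n with n ≠ r, (s n + s (up n)) := by
  classical
  have hcard (n : N) : ((G.neighborSet n).ncard : ℤ) =
      ∑ m, ((if n ≠ r ∧ up n = m then 1 else 0) + if m ≠ r ∧ up m = n then 1 else 0) := by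
    rw [Set.ncard_eq_toFinset_card', show (G.neighborSet n).toFinset =
      Finset.univ.filter (G.Adj n) by ext; simp, Finset.card_filter, Nat.cast_sum]
    refine Finset.sum_congr rfl fun m _ => ?_
    have h1 := h.adj_iff n m
    have h2 := h.adj_and_dist_lt_iff n m
    have h3 := h.adj_and_dist_lt_iff m n
    rw [← h2, ← h3] at h1
    simp only [← h2, ← h3]
    by_cases ha : G.Adj n m
    · have hb := ha.symm
      simp only [ha, hb, true_and, true_iff] at h1 ⊢
      rcases h1 with h1 | h1 <;> simp [h1, h1.le.not_gt]
    · have hb : ¬ G.Adj m n := fun hb => ha hb.symm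
      simp [ha, hb]
  simp only [hcard, Finset.sum_mul, Finset.sum_add_distrib, add_mul]
  congr 1
  · rw [Finset.sum_filter]
    refine Finset.sum_congr rfl fun n _ => ?_
    by_cases hn : n = r <;> simp [hn]
  · rw [Finset.sum_comm, Finset.sum_filter]
    refine Finset.sum_congr rfl fun n _ => ?_
    by_cases hn : n = r <;> simp [hn]

theorem sum_pairs (h : G.IsParent r up) (g : N → N → ℤ)
    [DecidablePred fun p : N × N => G.Adj p.1 p.2 ∧ G.dist p.2 r < G.dist p.1 r] :
    ∑ p : N × N with G.Adj p.1 p.2 ∧ G.dist p.2 r < G.dist p.1 r, g p.1 p.2 =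
      ∑ n with n ≠ r, g n (up n) := by
  classical
  simp only [h.adj_and_dist_lt_iff]
  rw [Finset.sum_filter, Fintype.sum_prod_type, Finset.sum_filter]
  refine Finset.sum_congr rfl fun n _ => ?_
  by_cases hn : n = r <;> simp [hn]

end SimpleGraph.IsParent

end RootedGraph

/-! ### The orbifold graph as a tree rooted at a node. -/

namespace PlumbingTree

variable {V : Type*} [Fintype V] (Γ : PlumbingTree V)

/-- `p` is the neighbour of `v` on the path from `v` to `r`. -/
def Closer (r v p : V) : Prop := Γ.graph.Adj v p ∧ Γ.graph.dist r v = Γ.graph.dist r p + 1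

variable {Γ}

theorem exists_closer {r v : V} (h : v ≠ r) : ∃ p, Γ.Closer r v p := by
  obtain ⟨w, hw⟩ := Γ.isTree.connected.exists_walk_length_eq_dist v r
  cases w with
  | nil => exact absurd rfl h
  | @cons _ p _ hadj q =>
    refine ⟨p, hadj, ?_⟩
    have h1 := SimpleGraph.dist_le q
    rw [SimpleGraph.Walk.length_cons] at hw
    rw [SimpleGraph.dist_comm] at hw h1
    rcases Γ.isTree.dist_eq_dist_add_one_of_adj r hadj with h2 | h2 <;> omega

/-- A neighbour closer to `r` must be the penultimate vertex of the path from `r` to `v`: otherwise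
the path to it would pass through `v` and be too long. -/
theorem Closer.unique {r v a b : V} (ha : Γ.Closer r v a) (hb : Γ.Closer r v b) : a = b := by
  obtain ⟨p, hp, hpl⟩ := Γ.isTree.connected.exists_path_of_dist r v
  have key : ∀ {a}, Γ.Closer r v a → a = p.penultimate := by
    intro a ha
    obtain ⟨q, hq, hql⟩ := Γ.isTree.connected.exists_path_of_dist r a
    refine Γ.isTree.isAcyclic.eq_penultimate_of_adj_end hp ha.1
      (Γ.isTree.isAcyclic.mem_support_of_ne_mem_support_of_adj_of_isPath hp hq ha.1 fun hv => ?_)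
    have h1 := congrArg SimpleGraph.Walk.length (Γ.isTree.isAcyclic.path_concat hp hq ha.1 hv)
    rw [SimpleGraph.Walk.length_concat, hql, hpl, ha.2] at h1
    omega
  rw [key ha, key hb]

theorem closer_or_closer (r : V) {v w : V} (h : Γ.graph.Adj v w) :
    Γ.Closer r v w ∨ Γ.Closer r w v := by
  rcases Γ.isTree.dist_eq_dist_add_one_of_adj r h with h2 | h2
  · exact Or.inl ⟨h, h2⟩
  · exact Or.inr ⟨h.symm, h2⟩

variable (Γ) in
/-- `n` is the first node on the path from `v` to `r` after `v`. -/
inductive Climb (r : V) : V → Γ.Node → Prop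
  | base {v : V} {n : Γ.Node} : Γ.Closer r v n → Climb r v n
  | step {v p : V} {n : Γ.Node} : Γ.Closer r v p → ¬ 3 ≤ Γ.valency p → Climb r p n → Climb r v n

/-- The climb stops at the latest at `r`, which is itself a node. -/
theorem exists_climb (r : Γ.Node) {v : V} (hv : v ≠ r) : ∃ n, Γ.Climb r v n := by
  induction hd : Γ.graph.dist r v using Nat.strong_induction_on generalizing v with
  | _ d ih =>
    obtain ⟨p, hp⟩ := exists_closer hv
    by_cases h3 : 3 ≤ Γ.valency p
    · exact ⟨⟨p, h3⟩, .base hp⟩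
    · obtain ⟨n, hn⟩ := ih _ (by have := hp.2; omega) (v := p) (fun h => h3 (h ▸ r.2)) rfl
      exact ⟨n, .step hp h3 hn⟩

theorem Climb.unique {r v : V} {n m : Γ.Node} (hn : Γ.Climb r v n) (hm : Γ.Climb r v m) :
    n = m := by
  induction hn with
  | @base v n hp =>
    cases hm with
    | base hq => exact Subtype.ext (hp.unique hq)
    | step hq h3 _ => exact absurd n.2 (hp.unique hq ▸ h3)
  | @step v p n hp h3 _ ih =>
    cases hm with
    | base hq => exact absurd m.2 (hp.unique hq ▸ h3)
    | step hq _ h => exact ih (hp.unique hq ▸ h)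

theorem Climb.dist_lt {r v : V} {n : Γ.Node} (h : Γ.Climb r v n) :
    Γ.graph.dist r n < Γ.graph.dist r v := by
  induction h with
  | base hp => have := hp.2; omega
  | step hp _ _ ih => have := hp.2; omega

theorem Climb.exists_closer {r v : V} {n : Γ.Node} (h : Γ.Climb r v n) :
    ∃ p, Γ.Closer r v p := by
  cases h with
  | base hp => exact ⟨_, hp⟩
  | step hp _ _ => exact ⟨_, hp⟩

theorem Closer.ne_of_closer {r u v q : V} (hu : Γ.Closer r u v) (hq : Γ.Closer r v q) :
    u ≠ q := by
  rintro rfl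
  have := hu.2
  have := hq.2
  omega

theorem Climb.exists_walk {r v : V} {n : Γ.Node} (h : Γ.Climb r v n) :
    ∃ p : Γ.graph.Walk v n, p.IsPath ∧
      (∀ x ∈ p.support, Γ.graph.dist r x ≤ Γ.graph.dist r v) ∧
      ∀ x ∈ p.support, x ≠ v → x ≠ n → Γ.valency x = 2 := by
  induction h with
  | @base v n hp =>
    have hlt := hp.2
    refine ⟨.cons hp.1 .nil, by simpa using hp.1.ne, ?_, ?_⟩
    · intro x hx
      simp only [SimpleGraph.Walk.support_cons, SimpleGraph.Walk.support_nil, List.mem_cons,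
        List.not_mem_nil, or_false] at hx
      rcases hx with rfl | rfl <;> omega
    · intro x hx h1 h2
      simp [h1, h2] at hx
  | @step v p n hp h3 hc ih =>
    obtain ⟨w, hw, hd, h2⟩ := ih
    have hlt := hp.2
    refine ⟨.cons hp.1 w, hw.cons fun hv => ?_, ?_, ?_⟩
    · have := hd v hv
      omega
    · intro x hx
      rw [SimpleGraph.Walk.support_cons, List.mem_cons] at hx
      rcases hx with rfl | hx
      · rfl
      · have := hd x hx
        omega
    · intro x hx hxv hxn
      rw [SimpleGraph.Walk.support_cons, List.mem_cons] at hx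
      rcases eq_or_ne x p with rfl | hxp
      · obtain ⟨q, hq⟩ := hc.exists_closer
        -- A vertex passed on the climb has a neighbour below and one above; not being a node, it
        -- has valency exactly two.
        have : 1 < Γ.valency x :=
          (Set.one_lt_ncard_iff (Set.toFinite _)).2 ⟨v, q, hp.1.symm, hq.1, hp.ne_of_closer hq⟩
        omega
      · exact h2 x (hx.resolve_left hxv) hxp hxn

theorem Climb.adj {r : V} {n m : Γ.Node} (h : Γ.Climb r n m) : Γ.orbGraph.Adj n m := by
  obtain ⟨p, hp, -, h2⟩ := h.exists_walk
  refine ⟨?_, p, hp, h2⟩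
  rintro rfl
  exact lt_irrefl _ h.dist_lt

/-- A path that starts towards `r` cannot turn at a vertex of valency two: the only neighbour
besides the one it came from is the closer one. -/
theorem Closer.climb_of_isPath (r : Γ.Node) {u v m : V} (h : Γ.Closer r u v)
    (w : Γ.graph.Walk v m) (hm : 3 ≤ Γ.valency m) (hw : w.IsPath) (hu : u ∉ w.support)
    (h2 : ∀ x ∈ w.support, x ≠ m → Γ.valency x = 2) : Γ.Climb r u ⟨m, hm⟩ := by
  induction w generalizing u with
  | nil => exact .base h
  | @cons v x m hadj w ih =>
    rw [SimpleGraph.Walk.cons_isPath_iff] at hw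
    have hvm : v ≠ m := fun hvm => hw.2 (hvm ▸ w.end_mem_support)
    have hv2 : Γ.valency v = 2 := h2 v (by simp) hvm
    have hvr : v ≠ r := by
      rintro rfl
      have := r.2
      omega
    obtain ⟨q, hq⟩ := PlumbingTree.exists_closer hvr
    have hux : u ≠ x := by
      rintro rfl
      exact hu (by simp)
    have hxq : x = q := by
      by_contra hxq
      have : 2 < Γ.valency v :=
        (Set.two_lt_ncard_iff (Set.toFinite _)).2 ⟨u, q, x, h.1.symm, hq.1, hadj, h.ne_of_closer hq, hux, Ne.symm hxq⟩
      omega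
    subst hxq
    exact .step h (by omega) (ih hq hm hw.1 hw.2 fun y hy => h2 y (by simp [hy]))

/-- A path that starts away from `r` keeps moving away, as the unique closer neighbour `z` is
avoided. Read backwards, it extends the climb to `n`. -/
theorem Climb.climb_of_isPath {r : V} {v z m : V} {n : Γ.Node} (h : Γ.Climb r v n)
    (hz : Γ.Closer r v z) (w : Γ.graph.Walk v m) (hw : w.IsPath) (hzw : z ∉ w.support)
    (h2 : ∀ x ∈ w.support, x ≠ m → Γ.valency x = 2) : Γ.Climb r m n := by
  induction w generalizing z with
  | nil => exact h
  | @cons v x m hadj w ih =>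
    rw [SimpleGraph.Walk.cons_isPath_iff] at hw
    have hvm : v ≠ m := fun hvm => hw.2 (hvm ▸ w.end_mem_support)
    have hv2 : Γ.valency v = 2 := h2 v (by simp) hvm
    have hxv : Γ.Closer r x v := by
      refine (closer_or_closer r hadj).resolve_left fun hx => hzw ?_
      rw [hz.unique hx]
      simp
    exact ih (.step hxv (by omega) h) hxv hw.1 hw.2 fun y hy => h2 y (by simp [hy])

theorem climb_or_climb_of_adj (r : Γ.Node) {n m : Γ.Node} (h : Γ.orbGraph.Adj n m) :
    Γ.Climb r n m ∨ Γ.Climb r m n := by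
  obtain ⟨n, hn⟩ := n
  obtain ⟨m, hm⟩ := m
  obtain ⟨hne, p, hp, h2⟩ := h
  cases p with
  | nil => exact absurd rfl hne
  | @cons _ v _ hadj w =>
    rw [SimpleGraph.Walk.cons_isPath_iff] at hp
    have h2' : ∀ x ∈ w.support, x ≠ m → Γ.valency x = 2 := fun x hx hxm =>
      h2 x (by simp [hx]) (fun hxn => hp.2 (hxn ▸ hx)) hxm
    rcases closer_or_closer (Γ := Γ) (r : V) (show Γ.graph.Adj n v from hadj) with hc | hc
    · exact Or.inl (hc.climb_of_isPath r w hm hp.1 hp.2 h2')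
    · exact Or.inr (Climb.climb_of_isPath (.base hc) hc w hp.1 hp.2 h2')

theorem exists_isParent_orbGraph (r : Γ.Node) : ∃ up, Γ.orbGraph.IsParent r up := by
  have hex : ∀ n : Γ.Node, ∃ m, n ≠ r → Γ.Climb r n m := fun n => by
    by_cases hn : n = r
    · exact ⟨r, fun h => absurd hn h⟩
    · obtain ⟨m, hm⟩ := exists_climb r (v := n) fun h => hn (Subtype.ext h)
      exact ⟨m, fun _ => hm⟩
  choose up hup using hex
  have hne : ∀ {n m : Γ.Node}, Γ.Climb r n m → n ≠ r := by
    rintro n m h rfl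
    have := h.dist_lt
    simp at this
  refine ⟨up, fun n m => ⟨fun h => ?_, ?_⟩, fun n => ?_⟩
  · rcases climb_or_climb_of_adj r h with h | h
    · exact Or.inl ⟨hne h, (hup _ (hne h)).unique h⟩
    · exact Or.inr ⟨hne h, (hup _ (hne h)).unique h⟩
  · rintro (⟨hn, rfl⟩ | ⟨hm, rfl⟩)
    · exact (hup n hn).adj
    · exact (hup m hm).adj.symm
  -- The induction uses the distance in `Γ`, which climbing decreases.
  · induction hd : Γ.graph.dist r n using Nat.strong_induction_on generalizing n with
    | _ d ih =>
      by_cases hn : n = r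
      · rw [hn]
      · exact (hup n hn).adj.reachable.trans (ih _ (hd ▸ (hup n hn).dist_lt) _ rfl)

end PlumbingTree
end

noncomputable section
-- Comparison of coefficients.
namespace PlumbingTree

open Laurent

variable {V : Type*} [Fintype V] {Γ : PlumbingTree V}

theorem IsPolynomialPart.unique {f : LaurentFrac Γ.Node} {P P' : Laurent Γ.Node}
    (h : Γ.IsPolynomialPart f P) (h' : Γ.IsPolynomialPart f P') : P = P' := by
  classical
  obtain ⟨P₁, P₂, h₁, h₂, rfl⟩ := h
  obtain ⟨P₁', P₂', h₁', h₂', rfl⟩ := h'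
  congr 1
  · exact Finset.sum_congr rfl fun e he =>
      (h₂ e (SimpleGraph.mem_edgeFinset.1 he)).unique (h₂' e (SimpleGraph.mem_edgeFinset.1 he))
  · exact Finset.sum_congr rfl fun n _ => by rw [(h₁ n).unique (h₁' n)]

open Classical in
/-- Summing the signs over the edges and the vertices of the orbifold tree gives the multiplicity
function. -/
theorem sum_sign_eq_multiplicity (n₀ : Γ.Node) (β : Γ.Node → ℚ) :
    (∑ e ∈ Γ.orbGraph.edgeFinset, if ∀ n ∈ e, β n < 0 then (0 : ℤ) else 1) -
      ∑ n, ((Γ.orbValency n : ℤ) - 1) * (if β n < 0 then 0 else 1) = Γ.multiplicity n₀ β := by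
  obtain ⟨up, hup⟩ := exists_isParent_orbGraph n₀
  set s : Γ.Node → ℤ := fun n => if β n < 0 then 0 else 1 with hs
  have h1 : ∑ n, ((Γ.orbValency n : ℤ) - 1) * s n =
      ∑ n with n ≠ n₀, (s n + s (up n)) - ∑ n, s n := by
    rw [← hup.sum_ncard_neighborSet_mul, ← Finset.sum_sub_distrib]
    exact Finset.sum_congr rfl fun n _ => by rw [orbValency]; ring
  have h2 : ∑ n, s n = s n₀ + ∑ n with n ≠ n₀, s n := by
    rw [← Finset.add_sum_erase _ _ (Finset.mem_univ n₀), Finset.filter_ne']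
  have h3 : Γ.multiplicity n₀ β = s n₀ + ∑ n with n ≠ n₀, Γ.edgeSign n (up n) β := by
    rw [multiplicity, nodeSign, hs]
    congr 1
    · by_cases h : β n₀ < 0
      · simp [h]
      · simp [h, not_lt.1 h]
    · rw [← hup.sum_pairs fun n m => Γ.edgeSign n m β]
      exact Finset.sum_congr (Finset.filter_congr fun p _ => Iff.rfl) fun _ _ => rfl
  -- The terms `s n` cancel for `n ≠ n₀`. The edge indicator minus `s (up n)` remains, and it is `1`
  -- exactly when `β n ≥ 0` and `β (up n) < 0`.
  rw [h1, h2, h3, hup.sum_edgeFinset, sub_sub_eq_add_sub, add_left_comm, add_sub_assoc,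
    ← Finset.sum_add_distrib, ← Finset.sum_sub_distrib]
  congr 1
  refine Finset.sum_congr rfl fun n _ => ?_
  simp only [hs, edgeSign, Sym2.mem_iff, forall_eq_or_imp, forall_eq]
  by_cases ha : β n < 0 <;> by_cases hb : β (up n) < 0 <;> simp [ha, hb, not_lt.1]

end PlumbingTree

open PlumbingTree Laurent in
-- All the polynomial parts are truncations of the same `Q`, so the coefficient at `β` is that of
-- `Q` times a signed count of the truncations that keep `β`.
theorem IsDivisionQuotient.isPolynomialPart {V : Type*} [Fintype V] {Γ : PlumbingTree V}
    {f : LaurentFrac Γ.Node} {Q : Laurent Γ.Node} (h : IsDivisionQuotient f Q) (n₀ : Γ.Node) :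
    Γ.IsPolynomialPart f
      (∑ β ∈ Q.exponents, AddMonoidAlgebra.single β (Γ.multiplicity n₀ β * Q.coeff β)) := by
  classical
  refine ⟨fun n => part {β | ∀ m ∈ ({n} : Set Γ.Node), β m < 0}ᶜ Q,
    fun e => part {β | ∀ m ∈ {m | m ∈ e}, β m < 0}ᶜ Q,
    fun n => h.isPolynomialPartIn {n}, fun e _ => h.isPolynomialPartIn {m | m ∈ e}, ?_⟩
  ext β
  have hl : (∑ β ∈ Q.exponents, AddMonoidAlgebra.single β (Γ.multiplicity n₀ β * Q.coeff β) :
      Laurent Γ.Node).coeff β = Γ.multiplicity n₀ β * Q.coeff β := by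
    rw [AddMonoidAlgebra.coeff_sum, Finsupp.finsetSum_apply]
    simp only [AddMonoidAlgebra.coeff_single, Finsupp.single_apply, Finset.sum_ite_eq']
    by_cases hβ : β ∈ Q.exponents
    · rw [if_pos hβ]
    · rw [if_neg hβ, not_not.1 (mem_exponents.not.1 hβ), mul_zero]
  rw [hl, ← sum_sign_eq_multiplicity, sub_mul, Finset.sum_mul, Finset.sum_mul,
    AddMonoidAlgebra.coeff_sub, Finsupp.sub_apply, AddMonoidAlgebra.coeff_sum,
    AddMonoidAlgebra.coeff_sum, Finsupp.finsetSum_apply, Finsupp.finsetSum_apply]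
  congr 1
  · refine Finset.sum_congr (by congr!) fun e _ => ?_
    rw [coeff_part_compl]
    by_cases hβ : ∀ n ∈ e, β n < 0
    · rw [if_pos hβ, if_pos]
      exact hβ
    · rw [if_neg hβ, if_neg]
      exact hβ
  · refine Finset.sum_congr rfl fun n _ => ?_
    rw [AddMonoidAlgebra.coeff_smul, Finsupp.smul_apply, smul_eq_mul, coeff_part_compl, mul_assoc]
    simp

end

theorem mainTheorem1 {V : Type*} [Fintype V] (Γ : PlumbingTree V) (h : Γ.H) (n₀ : Γ.Node) :
    (∃! f : LaurentFrac Γ.Node, Γ.IsReducedZeta h f) ∧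
    ∀ f : LaurentFrac Γ.Node, Γ.IsReducedZeta h f →
      (∃! Q : Laurent Γ.Node, IsDivisionQuotient f Q) ∧
      (∃! P : Laurent Γ.Node, Γ.IsPolynomialPart f P) ∧
      ∀ Q P : Laurent Γ.Node, IsDivisionQuotient f Q → Γ.IsPolynomialPart f P →
        P = ∑ β ∈ Q.exponents, AddMonoidAlgebra.single β (Γ.multiplicity n₀ β * Q.coeff β) := by
  have : Nonempty Γ.Node := ⟨n₀⟩
  obtain ⟨A, B, a, hA, ha, hf₀⟩ := Γ.exists_isReducedZeta h n₀
  refine ⟨⟨_, hf₀, fun f hf => hf.unique Γ hf₀⟩, fun f hf => ?_⟩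
  obtain rfl := hf.unique Γ hf₀
  obtain ⟨Q₀, hQ₀⟩ := hA.exists_isDivisionQuotient ha B
  exact ⟨⟨Q₀, hQ₀, fun Q hQ => hQ.unique hQ₀⟩,
    ⟨_, hQ₀.isPolynomialPart n₀, fun P hP => hP.unique (hQ₀.isPolynomialPart n₀)⟩,
    fun Q P hQ hP => hP.unique (hQ.isPolynomialPart n₀)⟩
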